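/- **Setting.** LTL formulas over a finite set $Ap$ of atomic propositions are built from $\mathbf{tt},\mathbf{ff}$, atoms, $\neg,\wedge,\vee,\mathbf X,\mathbf F,\mathbf G,\mathbf U$. The size $|\varphi|$ is the number of distinct subformulas of $\varphi$ (nodes of its syntax DAG; it is at most the length of $\varphi$). Every formula is first put into negation normal form by pushing negations to the atoms, with $\neg(\varphi\mathbf U\psi)$ rewritten as $(\neg\psi\,\mathbf U\,(\neg\varphi\wedge\neg\psi))\vee\mathbf G\neg\psi$; in what follows $\varphi$ denotes the normalized formula. Two formulas are propositionally equivalent ($\equiv_P$) if they are equivalent as propositional formulas in which each maximal subformula that is not a constant, a conjunction or a disjunction is read as a propositional variable. All formulas occurring in states below are taken modulo $\equiv_P$. For a letter $\nu\subseteq Ap$, $\mathit{af}(\cdot,\nu)$ commutes with $\mathbf{tt},\mathbf{ff},\wedge,\vee$; it maps a literal to its truth value under $\nu$; and $\mathit{af}(\mathbf X\chi,\nu)=\chi$, $\mathit{af}(\mathbf F\chi,\nu)=\mathit{af}(\chi,\nu)\vee\mathbf F\chi$, $\mathit{af}(\mathbf G\chi,\nu)=\mathit{af}(\chi,\nu)\wedge\mathbf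 G\chi$, $\mathit{af}(\chi\mathbf U\psi,\nu)=\mathit{af}(\psi,\nu)\vee(\mathit{af}(\chi,\nu)\wedge\chi\mathbf U\psi)$. Let $\mathit{Reach}(\chi)=\{\mathit{af}(\chi,w)\mid w\in(2^{Ap})^*\}$, where $\mathit{af}$ is extended letter by letter to finite words. Let $\mathbb G(\varphi)$ be the set of $\mathbf G$-subformulas of $\varphi$; for $\mathcal G\subseteq\mathbb G(\varphi)$, let $\chi[\mathcal G]$ be $\chi$ with each maximal occurrence of a formula of $\mathcal G$ replaced by $\mathbf{tt}$ and each maximal occurrence of a formula of $\mathbb G(\varphi)\setminus\mathcal G$ replaced by $\mathbf{ff}$. **The automaton.** The limit-deterministic Büchi automaton $\mathcal A_\varphi$ of Sickert et al. over the alphabet $2^{Ap}$ consists of two parts. * The initial component has the states $\mathit{Reach}(\varphi)$, the initial state $\varphi$ and the transitions $\chi\xrightarrow{\nu}\mathit{af}(\chi,\nu)$. * The accepting component is the disjoint union of subcomponents $\mathcal A_{\mathcal G}$, one for each $\mathcal G\subseteq\mathbb G(\varphi)$. The states of $\mathcal A_{\mathcal G}$ are the tuples $(\chi,(\xi_1^\psi,\xi_2^\psi)_{\mathbf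 G\psi\in\mathcal G})$, where $\chi\in\mathit{Reach}(\varphi'[\mathcal G])$ for some $\varphi'\in\mathit{Reach}(\varphi)$, and each $(\xi_1^\psi,\xi_2^\psi)$ is reachable from $(\psi',\mathbf{tt})$, with $\psi'=\psi[\mathcal G]$, under the breakpoint rule: on $\nu$, $(\xi_1,\xi_2)$ moves to $(\mathit{af}(\xi_2,\nu)\wedge\psi',\mathbf{tt})$ if $\mathit{af}(\xi_1,\nu)\equiv_P\mathbf{tt}$ (a breakpoint), and to $(\mathit{af}(\xi_1,\nu),\mathit{af}(\xi_2,\nu)\wedge\psi')$ otherwise. On $\nu$, $\chi$ moves to $\mathit{af}(\chi,\nu)$. * For each $\varphi'\in\mathit{Reach}(\varphi)$ and each $\mathcal G\subseteq\mathbb G(\varphi)$ there is an $\varepsilon$-transition from $\varphi'$ to the state $(\varphi'[\mathcal G],(\psi[\mathcal G],\mathbf{tt})_{\mathbf G\psi\in\mathcal G})$ of $\mathcal A_{\mathcal G}$. * A run (which may take finitely many $\varepsilon$-transitions before each letter) is accepting if, for some $\mathcal G$, it visits infinitely often transitions of $\mathcal A_{\mathcal G}$ whose source has $\chi\equiv_P\mathbf{tt}$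 and, for each $\mathbf G\psi\in\mathcal G$, it visits infinitely often such transitions that are also breakpoints of $(\xi_1^\psi,\xi_2^\psi)$. For a state $q$, $\mathsf L(q)$ is the set of words $w\in(2^{Ap})^\omega$ on which there is an accepting run starting in $q$. A finite set $\mathcal L_B$ of languages is a *base* of the automaton if, for every state $q$, $\mathsf L(q)$ is the union of some subset of $\mathcal L_B$; its size is $|\mathcal L_B|$. **Statement.** There is a constant $C\in\mathbb N$ such that for every finite set $Ap$ and every LTL formula $\varphi$ over $Ap$, the automaton of Sickert et al. for $\varphi$ has a base of size at most $2^{C|\varphi|}$; that is, it has a base of size $2^{O(|\varphi|)}$. -/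

import Mathlib

universe u

/-! ## Formulas -/

/-- Formulas of linear temporal logic over the atomic propositions `Ap`
(`nxt`, `ev`, `glob`, `untl` are the operators X, F, G, U). -/
inductive LTL (Ap : Type u) : Type u
  | tt : LTL Ap
  | ff : LTL Ap
  | atom : Ap → LTL Ap
  | neg : LTL Ap → LTL Ap
  | and : LTL Ap → LTL Ap → LTL Ap
  | or : LTL Ap → LTL Ap → LTL Ap
  | nxt : LTL Ap → LTL Ap
  | ev : LTL Ap → LTL Ap
  | glob : LTL Ap → LTL Ap
  | untl : LTL Ap → LTL Ap → LTL Ap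

/-- Formulas of linear temporal logic in negation normal form. -/
inductive NNF (Ap : Type u) : Type u
  | tt : NNF Ap
  | ff : NNF Ap
  | pos : Ap → NNF Ap
  | npos : Ap → NNF Ap
  | and : NNF Ap → NNF Ap → NNF Ap
  | or : NNF Ap → NNF Ap → NNF Ap
  | nxt : NNF Ap → NNF Ap
  | ev : NNF Ap → NNF Ap
  | glob : NNF Ap → NNF Ap
  | untl : NNF Ap → NNF Ap → NNF Ap

section Formulas

variable {Ap : Type u}

open Classical in
/-- The set of subformulas. -/
noncomputable def LTL.sf : LTL Ap → Finset (LTL Ap)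
  | .tt => {.tt}
  | .ff => {.ff}
  | .atom a => {.atom a}
  | .neg φ => insert (.neg φ) φ.sf
  | .and φ ψ => insert (.and φ ψ) (φ.sf ∪ ψ.sf)
  | .or φ ψ => insert (.or φ ψ) (φ.sf ∪ ψ.sf)
  | .nxt φ => insert (.nxt φ) φ.sf
  | .ev φ => insert (.ev φ) φ.sf
  | .glob φ => insert (.glob φ) φ.sf
  | .untl φ ψ => insert (.untl φ ψ) (φ.sf ∪ ψ.sf)

/-- The size of a formula: the number of nodes of its syntax DAG, that is, the number of its
distinct subformulas. It is at most the length of the formula. -/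
noncomputable def LTL.size (φ : LTL Ap) : ℕ := φ.sf.card

/-- `φ.nnfPol true` is the negation normal form of `φ`, `φ.nnfPol false` that of `¬ φ`.
The negation of `φ U ψ` is `(¬ψ U (¬φ ∧ ¬ψ)) ∨ G ¬ψ`. -/
def LTL.nnfPol : Bool → LTL Ap → NNF Ap
  | true, .tt => .tt
  | false, .tt => .ff
  | true, .ff => .ff
  | false, .ff => .tt
  | true, .atom a => .pos a
  | false, .atom a => .npos a
  | true, .neg φ => φ.nnfPol false
  | false, .neg φ => φ.nnfPol true
  | true, .and φ ψ => .and (φ.nnfPol true) (ψ.nnfPol true)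
  | false, .and φ ψ => .or (φ.nnfPol false) (ψ.nnfPol false)
  | true, .or φ ψ => .or (φ.nnfPol true) (ψ.nnfPol true)
  | false, .or φ ψ => .and (φ.nnfPol false) (ψ.nnfPol false)
  | b, .nxt φ => .nxt (φ.nnfPol b)
  | true, .ev φ => .ev (φ.nnfPol true)
  | false, .ev φ => .glob (φ.nnfPol false)
  | true, .glob φ => .glob (φ.nnfPol true)
  | false, .glob φ => .ev (φ.nnfPol false)
  | true, .untl φ ψ => .untl (φ.nnfPol true) (ψ.nnfPol true)
  | false, .untl φ ψ =>
      .or (.untl (ψ.nnfPol false) (.and (φ.nnfPol false) (ψ.nnfPol false)))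
        (.glob (ψ.nnfPol false))

/-- The negation normal form of a formula. -/
def LTL.nnf (φ : LTL Ap) : NNF Ap := φ.nnfPol true

namespace NNF

open Classical in
/-- The set of subformulas. -/
noncomputable def sf : NNF Ap → Finset (NNF Ap)
  | tt => {tt}
  | ff => {ff}
  | pos a => {pos a}
  | npos a => {npos a}
  | and φ ψ => insert (and φ ψ) (sf φ ∪ sf ψ)
  | or φ ψ => insert (or φ ψ) (sf φ ∪ sf ψ)
  | nxt φ => insert (nxt φ) (sf φ)
  | ev φ => insert (ev φ) (sf φ)
  | glob φ => insert (glob φ) (sf φ)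
  | untl φ ψ => insert (untl φ ψ) (sf φ ∪ sf ψ)

open Classical in
/-- The set of all `G`-subformulas of `φ`. -/
noncomputable def gsf (φ : NNF Ap) : Finset (NNF Ap) := φ.sf.filter fun χ => ∃ ψ, χ = glob ψ

open Classical in
/-- The formula "`φ` after the letter `ν`". -/
noncomputable def af : NNF Ap → Set Ap → NNF Ap
  | tt, _ => tt
  | ff, _ => ff
  | pos a, ν => if a ∈ ν then tt else ff
  | npos a, ν => if a ∈ ν then ff else tt
  | and φ ψ, ν => and (af φ ν) (af ψ ν)
  | or φ ψ, ν => or (af φ ν) (af ψ ν)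
  | nxt φ, _ => φ
  | ev φ, ν => or (af φ ν) (ev φ)
  | glob φ, ν => and (af φ ν) (glob φ)
  | untl φ ψ, ν => or (af ψ ν) (and (af φ ν) (untl φ ψ))

open Classical in
/-- The partial evaluation `φ[T, F]` for sets `T`, `F` of `G`-formulas: each maximal occurrence
of a formula of `T` is replaced by `tt`, each maximal occurrence of a formula of `F` by `ff`. -/
noncomputable def subst (T F : Finset (NNF Ap)) : NNF Ap → NNF Ap
  | tt => tt
  | ff => ff
  | pos a => pos a
  | npos a => npos a
  | and φ ψ => and (subst T F φ) (subst T F ψ)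
  | or φ ψ => or (subst T F φ) (subst T F ψ)
  | nxt φ => nxt (subst T F φ)
  | ev φ => ev (subst T F φ)
  | glob φ => if glob φ ∈ T then tt else if glob φ ∈ F then ff else glob (subst T F φ)
  | untl φ ψ => untl (subst T F φ) (subst T F ψ)

/-- The truth value of a formula read as a propositional formula, whose variables are the proper
formulas, that is, those that are neither Boolean constants nor conjunctions nor disjunctions. -/
def peval (I : NNF Ap → Prop) : NNF Ap → Prop
  | tt => True
  | ff => False
  | and φ ψ => peval I φ ∧ peval I ψ
  | or φ ψ => peval I φ ∨ peval I ψ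
  | φ => I φ

/-- Propositional equivalence. -/
def propSetoid (Ap : Type u) : Setoid (NNF Ap) where
  r φ ψ := ∀ I : NNF Ap → Prop, peval I φ ↔ peval I ψ
  iseqv :=
    { refl := fun _ _ => Iff.rfl
      symm := fun h I => (h I).symm
      trans := fun h₁ h₂ I => (h₁ I).trans (h₂ I) }

theorem peval_af (I : NNF Ap → Prop) (ν : Set Ap) (φ : NNF Ap) :
    peval I (φ.af ν) ↔ peval (fun χ => peval I (χ.af ν)) φ := by
  induction φ with
  | and φ ψ h₁ h₂ => simp only [af, peval, h₁, h₂]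
  | or φ ψ h₁ h₂ => simp only [af, peval, h₁, h₂]
  | _ => simp only [af, peval]

theorem peval_subst (I : NNF Ap → Prop) (T F : Finset (NNF Ap)) (φ : NNF Ap) :
    peval I (φ.subst T F) ↔ peval (fun χ => peval I (χ.subst T F)) φ := by
  induction φ with
  | and φ ψ h₁ h₂ => simp only [subst, peval, h₁, h₂]
  | or φ ψ h₁ h₂ => simp only [subst, peval, h₁, h₂]
  | _ => simp only [subst, peval]

end NNF

/-- Classes of formulas modulo propositional equivalence. -/
abbrev PClass (Ap : Type u) : Type u := Quotient (NNF.propSetoid Ap)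

namespace PClass

/-- The class of a formula. -/
def mk (φ : NNF Ap) : PClass Ap := Quotient.mk (NNF.propSetoid Ap) φ

/-- `af` on classes. -/
noncomputable def af (c : PClass Ap) (ν : Set Ap) : PClass Ap :=
  Quotient.map (sa := NNF.propSetoid Ap) (sb := NNF.propSetoid Ap) (fun φ => φ.af ν)
    (fun φ ψ h I => by rw [NNF.peval_af, NNF.peval_af]; exact h _) c

/-- Partial evaluation on classes. -/
noncomputable def subst (T F : Finset (NNF Ap)) (c : PClass Ap) : PClass Ap :=
  Quotient.map (sa := NNF.propSetoid Ap) (sb := NNF.propSetoid Ap) (fun φ => φ.subst T F)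
    (fun φ ψ h I => by rw [NNF.peval_subst, NNF.peval_subst]; exact h _) c

/-- Conjunction on classes. -/
def and (c d : PClass Ap) : PClass Ap :=
  Quotient.map₂ (sa := NNF.propSetoid Ap) (sb := NNF.propSetoid Ap) (sc := NNF.propSetoid Ap)
    NNF.and (fun _ _ h₁ _ _ h₂ I => and_congr (h₁ I) (h₂ I)) c d

/-- The classes reachable from `c` by `af`. -/
def reach (c : PClass Ap) : Set (PClass Ap) := {d | ∃ w : List (Set Ap), d = w.foldl af c}

end PClass

end Formulas

/-! ## Limit-deterministic Büchi automata -/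

/-- A limit-deterministic Büchi automaton with alphabet `A`, with acceptance on transitions.
As in the translation from LTL below, spontaneous (`ε`-) transitions are allowed outside of the
deterministic part `Qd`, and the acceptance condition is a finite nonempty family of sets
of transitions, each of which has to be visited infinitely often. A Büchi condition is
a family with one member. -/
structure LDBA (A : Type u) where
  Q : Type u
  finite_Q : Finite Q
  init : Q
  δ : Q → A → Q → Prop
  ε : Q → Q → Prop
  ι : Type u
  finite_ι : Finite ι
  nonempty_ι : Nonempty ι
  α : ι → Set (Q × A × Q)
  Qd : Set Q
  total : ∀ q a, ∃ q', δ q a q'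
  α_sub : ∀ i q a q', (q, a, q') ∈ α i → q ∈ Qd ∧ δ q a q' ∧ q' ∈ Qd
  det : ∀ q ∈ Qd, ∀ a q₁ q₂, δ q a q₁ → δ q a q₂ → q₁ = q₂
  trap : ∀ q ∈ Qd, ∀ a q', δ q a q' → q' ∈ Qd
  no_ε : ∀ q ∈ Qd, ∀ q', ¬ ε q q'
  init_notMem : init ∉ Qd

namespace LDBA

variable {A : Type u}

/-- The language `L(q)` recognized from the state `q`. In a run on `w`, before the letter `w n`
is read, the automaton moves from `ρ n` to `π n` by finitely many (possibly no) `ε`-transitions;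
it then reads `w n` and moves from `π n` to `ρ (n + 1)`. -/
def lang (M : LDBA A) (q : M.Q) : Set (ℕ → A) :=
  {w | ∃ ρ π : ℕ → M.Q, ρ 0 = q ∧
    (∀ n, Relation.ReflTransGen M.ε (ρ n) (π n) ∧ M.δ (π n) (w n) (ρ (n + 1))) ∧
    ∀ i, ∃ᶠ n in Filter.atTop, (π n, w n, ρ (n + 1)) ∈ M.α i}

/-- The finite set `B` of languages is a base of `M`: every state of `M` recognizes a union of
languages of `B`. -/
def HasBase (M : LDBA A) (B : Set (Set (ℕ → A))) : Prop :=
  B.Finite ∧ ∀ q : M.Q, ∃ S ⊆ B, M.lang q = ⋃₀ S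

end LDBA

/-! ## The translation from LTL -/

section Translation

variable {Ap : Type u}

namespace NNF

/-- The sets of `G`-subformulas of `φ`. -/
abbrev GSet (φ : NNF Ap) : Type u := {𝒢 : Finset (NNF Ap) // 𝒢 ⊆ φ.gsf}

open Classical in
/-- `ψ[𝒢]`, which is `ψ[𝒢, 𝔾(φ) \ 𝒢]`. -/
noncomputable def GSet.eval {φ : NNF Ap} (𝒢 : φ.GSet) (ψ : NNF Ap) : NNF Ap :=
  ψ.subst 𝒢.1 (φ.gsf \ 𝒢.1)

open Classical in
/-- `c[𝒢]` for a class `c`. -/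
noncomputable def GSet.evalClass {φ : NNF Ap} (𝒢 : φ.GSet) (c : PClass Ap) : PClass Ap :=
  c.subst 𝒢.1 (φ.gsf \ 𝒢.1)

/-- The states of the monitor for `φ[𝒢]`: all classes that are reachable from some `φ'[𝒢]`, where
`φ'` is a state of the initial component. (The monitor is entered in such states `φ'[𝒢]`.) -/
def monStates (φ : NNF Ap) (𝒢 : φ.GSet) : Set (PClass Ap) :=
  {c | ∃ φ' ∈ (PClass.mk φ).reach, c ∈ (𝒢.evalClass φ').reach}

open Classical in
/-- The transition function of the breakpoint monitor for `G ψ'`. -/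
noncomputable def bpStep (ψ' : NNF Ap) (p : PClass Ap × PClass Ap) (ν : Set Ap) :
    PClass Ap × PClass Ap :=
  if p.1.af ν = PClass.mk tt then ((p.2.af ν).and (PClass.mk ψ'), PClass.mk tt)
  else (p.1.af ν, (p.2.af ν).and (PClass.mk ψ'))

/-- The initial state of the breakpoint monitor for `G ψ'`. -/
def bpInit (ψ' : NNF Ap) : PClass Ap × PClass Ap := (PClass.mk ψ', PClass.mk tt)

/-- The states of the breakpoint monitor for `G ψ'`: all pairs reachable from the initial one. -/
def bpStates (ψ' : NNF Ap) : Set (PClass Ap × PClass Ap) :=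
  {p | ∃ w : List (Set Ap), p = w.foldl (bpStep ψ') (bpInit ψ')}

/-- The states of the subcomponent for `𝒢`: a state of the monitor for `φ[𝒢]`, and a state of the
monitor for `G (ψ[𝒢])` for each `G ψ ∈ 𝒢`. -/
abbrev CompState (φ : NNF Ap) (𝒢 : φ.GSet) : Type u :=
  φ.monStates 𝒢 × ((i : {ψ : NNF Ap // glob ψ ∈ 𝒢.1}) → bpStates (𝒢.eval i.1))

/-- The states of the automaton for `φ`: the initial component and the accepting component, which
is the disjoint union of the subcomponents. -/
abbrev AState (φ : NNF Ap) : Type u := (PClass.mk φ).reach ⊕ (Σ 𝒢 : φ.GSet, φ.CompState 𝒢)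

end NNF

theorem PClass.self_mem_reach (c : PClass Ap) : c ∈ c.reach := ⟨[], rfl⟩

theorem PClass.af_mem_reach {c d : PClass Ap} (h : d ∈ c.reach) (ν : Set Ap) :
    d.af ν ∈ c.reach := by
  obtain ⟨w, rfl⟩ := h
  exact ⟨w ++ [ν], by simp⟩

namespace NNF

theorem af_mem_monStates {φ : NNF Ap} {𝒢 : φ.GSet} {c : PClass Ap} (h : c ∈ φ.monStates 𝒢)
    (ν : Set Ap) : c.af ν ∈ φ.monStates 𝒢 := by
  obtain ⟨φ', h₁, h₂⟩ := h
  exact ⟨φ', h₁, PClass.af_mem_reach h₂ ν⟩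

theorem bpStep_mem {ψ' : NNF Ap} {p : PClass Ap × PClass Ap} (h : p ∈ bpStates ψ')
    (ν : Set Ap) : bpStep ψ' p ν ∈ bpStates ψ' := by
  obtain ⟨w, rfl⟩ := h
  exact ⟨w ++ [ν], by simp⟩

/-- The transition function of the subcomponent for `𝒢`. -/
noncomputable def CompState.step {φ : NNF Ap} {𝒢 : φ.GSet} (s : φ.CompState 𝒢) (ν : Set Ap) :
    φ.CompState 𝒢 :=
  (⟨s.1.1.af ν, af_mem_monStates s.1.2 ν⟩,
    fun i => ⟨bpStep (𝒢.eval i.1) (s.2 i).1 ν, bpStep_mem (s.2 i).2 ν⟩)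

/-- The transition function on letters: each of the two components is deterministic. -/
noncomputable def AState.step {φ : NNF Ap} : φ.AState → Set Ap → φ.AState
  | .inl c, ν => .inl ⟨c.1.af ν, PClass.af_mem_reach c.2 ν⟩
  | .inr ⟨𝒢, s⟩, ν => .inr ⟨𝒢, s.step ν⟩

/-- The state of the subcomponent for `𝒢` that the `ε`-transition for `𝒢` from the state `c` of
the initial component leads to. -/
noncomputable def jump {φ : NNF Ap} (c : (PClass.mk φ).reach) (𝒢 : φ.GSet) : φ.CompState 𝒢 :=
  (⟨𝒢.evalClass c.1, c.1, c.2, PClass.self_mem_reach _⟩,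
    fun i => ⟨bpInit (𝒢.eval i.1), [], rfl⟩)

/-- The accepting transitions. The member `none` of the family asks the monitor for `φ[𝒢]` to be
in its final state `tt`. The member `some ψ`, for a `G`-subformula `G ψ` of `φ`, asks moreover for
a breakpoint of the monitor for `G (ψ[𝒢])`, provided that `G ψ ∈ 𝒢`. -/
def accTrans (φ : NNF Ap) (i : Option {ψ : NNF Ap // glob ψ ∈ φ.gsf}) :
    Set (φ.AState × Set Ap × φ.AState) :=
  {t | ∃ (𝒢 : φ.GSet) (s : φ.CompState 𝒢) (ν : Set Ap),
    t = (.inr ⟨𝒢, s⟩, ν, .inr ⟨𝒢, s.step ν⟩) ∧ s.1.1 = PClass.mk tt ∧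
    ∀ ψ ∈ i, ∀ h : glob ψ.1 ∈ 𝒢.1, (s.2 ⟨ψ.1, h⟩).1.1.af ν = PClass.mk tt}

/-! ### Finiteness of the state space -/

/-- The propositional variables of a formula. -/
def patoms : NNF Ap → Set (NNF Ap)
  | tt => ∅
  | ff => ∅
  | and φ ψ => patoms φ ∪ patoms ψ
  | or φ ψ => patoms φ ∪ patoms ψ
  | φ => {φ}

theorem peval_congr {I J : NNF Ap → Prop} (φ : NNF Ap) (h : ∀ χ ∈ patoms φ, (I χ ↔ J χ)) :
    peval I φ ↔ peval J φ := by
  induction φ with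
  | and φ ψ h₁ h₂ =>
    exact and_congr (h₁ fun χ hχ => h χ (Or.inl hχ)) (h₂ fun χ hχ => h χ (Or.inr hχ))
  | or φ ψ h₁ h₂ =>
    exact or_congr (h₁ fun χ hχ => h χ (Or.inl hχ)) (h₂ fun χ hχ => h χ (Or.inr hχ))
  | tt => exact Iff.rfl
  | ff => exact Iff.rfl
  | _ => exact h _ rfl

/-- The classes of the Boolean combinations of formulas of `S`. -/
def boolComb (S : Set (NNF Ap)) : Set (PClass Ap) := {c | ∃ φ, c = PClass.mk φ ∧ patoms φ ⊆ S}

theorem finite_boolComb {S : Set (NNF Ap)} (hS : S.Finite) : (boolComb S).Finite := by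
  have : Finite S := hS
  let f : boolComb S → Set (Set S) := fun c =>
    {I | peval (fun χ => ∃ h : χ ∈ S, (⟨χ, h⟩ : S) ∈ I) c.2.choose}
  have hf : Function.Injective f := by
    intro c d hcd
    have hc := c.2.choose_spec
    have hd := d.2.choose_spec
    apply Subtype.ext
    rw [hc.1, hd.1]
    refine Quotient.sound (s := propSetoid Ap) fun I => ?_
    have key : ∀ φ : NNF Ap, patoms φ ⊆ S →
        (peval I φ ↔ peval (fun χ => ∃ h : χ ∈ S, (⟨χ, h⟩ : S) ∈ {x : S | I x.1}) φ) := by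
      intro φ hφ
      exact peval_congr φ fun χ hχ => ⟨fun h => ⟨hφ hχ, h⟩, fun ⟨_, h⟩ => h⟩
    rw [key _ hc.2, key _ hd.2]
    have : ({x : S | I x.1} ∈ f c) = ({x : S | I x.1} ∈ f d) := by rw [hcd]
    exact Iff.of_eq this
  exact Finite.of_injective f hf

theorem self_mem_sf (φ : NNF Ap) : φ ∈ φ.sf := by cases φ <;> simp [sf]

theorem patoms_subset_sf (φ : NNF Ap) : patoms φ ⊆ (φ.sf : Set (NNF Ap)) := by
  induction φ with
  | and φ ψ h₁ h₂ =>
    intro χ hχ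
    rcases hχ with hχ | hχ
    · have := h₁ hχ; simp_all [sf]
    · have := h₂ hχ; simp_all [sf]
  | or φ ψ h₁ h₂ =>
    intro χ hχ
    rcases hχ with hχ | hχ
    · have := h₁ hχ; simp_all [sf]
    · have := h₂ hχ; simp_all [sf]
  | tt => simp [patoms]
  | ff => simp [patoms]
  | _ => simp [patoms, sf]

theorem sf_trans {φ χ : NNF Ap} (h : χ ∈ φ.sf) : χ.sf ⊆ φ.sf := by
  classical
  induction φ with
  | tt | ff | pos | npos => simp [sf] at h; subst h; rfl
  | nxt φ ih | ev φ ih | glob φ ih =>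
    rw [sf, Finset.mem_insert] at h
    rcases h with rfl | h
    · rfl
    · exact (ih h).trans (by rw [sf]; exact Finset.subset_insert _ _)
  | and φ ψ h₁ h₂ | or φ ψ h₁ h₂ | untl φ ψ h₁ h₂ =>
    rw [sf, Finset.mem_insert, Finset.mem_union] at h
    rcases h with rfl | h | h
    · rfl
    · refine (h₁ h).trans fun x hx => ?_
      simp [sf, hx]
    · refine (h₂ h).trans fun x hx => ?_
      simp [sf, hx]

theorem patoms_af_sf (φ : NNF Ap) (ν : Set Ap) : patoms (φ.af ν) ⊆ (φ.sf : Set (NNF Ap)) := by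
  induction φ with
  | tt | ff => simp [af, patoms]
  | pos | npos => rw [af]; split <;> simp [patoms]
  | nxt φ ih =>
    intro χ hχ
    have := patoms_subset_sf φ hχ
    simp_all [sf]
  | ev φ ih | glob φ ih =>
    intro χ hχ
    rcases hχ with hχ | hχ
    · have := ih hχ; simp_all [sf]
    · simp_all [sf, patoms]
  | and φ ψ h₁ h₂ | or φ ψ h₁ h₂ =>
    intro χ hχ
    rcases hχ with hχ | hχ
    · have := h₁ hχ; simp_all [sf]
    · have := h₂ hχ; simp_all [sf]
  | untl φ ψ h₁ h₂ =>
    intro χ hχ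
    rcases hχ with hχ | hχ | hχ
    · have := h₂ hχ; simp_all [sf]
    · have := h₁ hχ; simp_all [sf]
    · simp_all [sf, patoms]

theorem patoms_af {φ χ : NNF Ap} (h : patoms χ ⊆ (φ.sf : Set (NNF Ap))) (ν : Set Ap) :
    patoms (χ.af ν) ⊆ (φ.sf : Set (NNF Ap)) := by
  induction χ with
  | and χ₁ χ₂ h₁ h₂ | or χ₁ χ₂ h₁ h₂ =>
    have h' := Set.union_subset_iff.1 h
    exact Set.union_subset (h₁ h'.1) (h₂ h'.2)
  | tt | ff => simp [af, patoms]
  | _ =>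
    exact (patoms_af_sf _ ν).trans (Finset.coe_subset.2 (sf_trans (h rfl)))

theorem af_mem_boolComb {φ : NNF Ap} {c : PClass Ap} (h : c ∈ boolComb (φ.sf : Set (NNF Ap)))
    (ν : Set Ap) : c.af ν ∈ boolComb (φ.sf : Set (NNF Ap)) := by
  obtain ⟨χ, rfl, hχ⟩ := h
  exact ⟨χ.af ν, rfl, patoms_af hχ ν⟩

theorem and_mem_boolComb {S : Set (NNF Ap)} {c d : PClass Ap} (hc : c ∈ boolComb S)
    (hd : d ∈ boolComb S) : c.and d ∈ boolComb S := by
  obtain ⟨χ, rfl, hχ⟩ := hc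
  obtain ⟨ξ, rfl, hξ⟩ := hd
  exact ⟨χ.and ξ, rfl, Set.union_subset hχ hξ⟩

theorem self_mem_boolComb (φ : NNF Ap) : PClass.mk φ ∈ boolComb (φ.sf : Set (NNF Ap)) :=
  ⟨φ, rfl, patoms_subset_sf φ⟩

theorem finite_reach (c : PClass Ap) : c.reach.Finite := by
  obtain ⟨φ, rfl⟩ := (Quotient.exists_rep c : ∃ φ, PClass.mk φ = c)
  refine (finite_boolComb φ.sf.finite_toSet).subset ?_
  rintro _ ⟨w, rfl⟩
  induction w using List.reverseRecOn with
  | nil => exact self_mem_boolComb φ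
  | append_singleton w ν ih => rw [List.foldl_append]; exact af_mem_boolComb ih ν

theorem finite_monStates (φ : NNF Ap) (𝒢 : φ.GSet) : (φ.monStates 𝒢).Finite := by
  refine ((finite_reach (PClass.mk φ)).biUnion
    fun c _ => finite_reach (𝒢.evalClass c)).subset ?_
  rintro c ⟨φ', h₁, h₂⟩
  exact Set.mem_biUnion h₁ h₂

theorem finite_bpStates (ψ' : NNF Ap) : (bpStates ψ').Finite := by
  have hfin := finite_boolComb ψ'.sf.finite_toSet
  have htt : PClass.mk tt ∈ boolComb (ψ'.sf : Set (NNF Ap)) := ⟨tt, rfl, by simp [patoms]⟩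
  refine (hfin.prod hfin).subset ?_
  rintro _ ⟨w, rfl⟩
  induction w using List.reverseRecOn with
  | nil => exact ⟨self_mem_boolComb ψ', htt⟩
  | append_singleton w ν ih =>
    rw [List.foldl_append, List.foldl_cons, List.foldl_nil, bpStep]
    have h₂ := and_mem_boolComb (af_mem_boolComb ih.2 ν) (self_mem_boolComb ψ')
    split
    · exact ⟨h₂, htt⟩
    · exact ⟨af_mem_boolComb ih.1 ν, h₂⟩

theorem finite_AState (φ : NNF Ap) : Finite φ.AState := by
  have h₁ : Finite (PClass.mk φ).reach := finite_reach _
  have h₂ : Finite φ.GSet := by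
    have : Finite {𝒢 : Finset (NNF Ap) | 𝒢 ⊆ φ.gsf} := by
      refine Set.Finite.subset φ.gsf.powerset.finite_toSet fun 𝒢 h => ?_
      simpa using h
    exact this
  have h₃ : ∀ 𝒢 : φ.GSet, Finite (φ.CompState 𝒢) := by
    intro 𝒢
    have : Finite (φ.monStates 𝒢) := finite_monStates φ 𝒢
    have : Finite {ψ : NNF Ap // glob ψ ∈ 𝒢.1} :=
      Finite.of_injective (fun i => (⟨glob i.1, i.2⟩ : {χ // χ ∈ 𝒢.1})) fun i j h => by
        simpa [Subtype.ext_iff] using h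
    have : ∀ i : {ψ : NNF Ap // glob ψ ∈ 𝒢.1}, Finite (bpStates (𝒢.eval i.1)) :=
      fun i => finite_bpStates _
    infer_instance
  infer_instance

/-- The limit-deterministic Büchi automaton of Sickert, Esparza, Jaax and Křetínský for the
formula `φ` in negation normal form. -/
noncomputable def ldba (φ : NNF Ap) : LDBA (Set Ap) where
  Q := φ.AState
  finite_Q := finite_AState φ
  init := .inl ⟨PClass.mk φ, PClass.self_mem_reach _⟩
  δ q ν q' := q' = q.step ν
  ε q q' := ∃ (c : (PClass.mk φ).reach) (𝒢 : φ.GSet), q = .inl c ∧ q' = .inr ⟨𝒢, jump c 𝒢⟩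
  ι := Option {ψ : NNF Ap // glob ψ ∈ φ.gsf}
  finite_ι := by
    have : Finite {ψ : NNF Ap // glob ψ ∈ φ.gsf} :=
      Finite.of_injective (fun i => (⟨glob i.1, i.2⟩ : {χ // χ ∈ φ.gsf})) fun i j h => by
        simpa [Subtype.ext_iff] using h
    infer_instance
  nonempty_ι := ⟨none⟩
  α := φ.accTrans
  Qd := Set.range Sum.inr
  total q ν := ⟨_, rfl⟩
  α_sub := by
    rintro i q ν q' ⟨𝒢, s, μ, h, -⟩
    simp only [Prod.mk.injEq] at h
    obtain ⟨rfl, rfl, rfl⟩ := h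
    exact ⟨⟨_, rfl⟩, rfl, ⟨_, rfl⟩⟩
  det := by
    rintro q - ν q₁ q₂ rfl rfl
    rfl
  trap := by
    rintro _ ⟨s, rfl⟩ ν q' rfl
    exact ⟨_, rfl⟩
  no_ε := by
    rintro _ ⟨s, rfl⟩ q' ⟨c, 𝒢, h, -⟩
    cases h
  init_notMem := by
    rintro ⟨s, h⟩
    cases h

end NNF

/-- The automaton for an arbitrary formula, which is first put into negation normal form. -/
noncomputable def LTL.ldba (φ : LTL Ap) : LDBA (Set Ap) := φ.nnf.ldba

end Translation

/-! The language of every state has a plain semantic description. A state of the initial component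
accepts the words that satisfy its formula. A state of `𝒜_𝒢` accepts the words that satisfy `χ`, all
`ξ₁` and `ξ₂`, and `X G (ψ[𝒢])` for every `G ψ ∈ 𝒢`. This is `mem_lang_iff`; the base is then
obtained by counting.

For soundness, this condition is preserved in both directions by letter transitions, an
`ε`-transition only strengthens it (`sat_of_sat_jump`), and recurring acceptance inside a
subcomponent forces it. For completeness, on a fixed word let `𝒢` consist of the `G`-subformulas
that hold from some position on, and jump once all of them hold: from then on `χ` and `χ[𝒢]` agree
(`exists_sat_jump`). The formulas in a subcomponent are `G`-free, so their truth is witnessed by a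
finite prefix and `af` turns them into `tt` (`GFree.evTrue`); this yields the accepting transitions.

Every formula in a state is a monotone Boolean combination of subformulas of `φ` or, in `𝒜_𝒢`, of
the formulas `χ[𝒢]` with `χ` a subformula of `φ`. Its language is therefore a union of languages
given by conjunctions of such formulas. The remaining `X G` part depends on `𝒢` alone. So languages
indexed by sets of subformulas, and by pairs of `𝒢` and such a set, suffice. Their number is
exponential in the number of subformulas of the normal form, which is linear in `|φ|`, although the
number of states may be doubly exponential. -/

namespace NNF

variable {Ap : Type u}

/-! ### Semantics, expansion laws and partial evaluation -/

/-- `Sat w φ k`: the suffix of the word `w` from position `k` on satisfies `φ`. -/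
def Sat (w : ℕ → Set Ap) : NNF Ap → ℕ → Prop
  | tt, _ => True
  | ff, _ => False
  | pos a, k => a ∈ w k
  | npos a, k => a ∉ w k
  | and φ ψ, k => Sat w φ k ∧ Sat w ψ k
  | or φ ψ, k => Sat w φ k ∨ Sat w ψ k
  | nxt φ, k => Sat w φ (k + 1)
  | ev φ, k => ∃ j ≥ k, Sat w φ j
  | glob φ, k => ∀ j ≥ k, Sat w φ j
  | untl φ ψ, k => ∃ j ≥ k, Sat w ψ j ∧ ∀ i, k ≤ i → i < j → Sat w φ i

theorem peval_sat (w : ℕ → Set Ap) (k : ℕ) (φ : NNF Ap) :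
    peval (fun χ => Sat w χ k) φ ↔ Sat w φ k := by
  induction φ with
  | and φ ψ h₁ h₂ => simp only [Sat, peval, h₁, h₂]
  | or φ ψ h₁ h₂ => simp only [Sat, peval, h₁, h₂]
  | _ => simp only [Sat, peval]

/-- In negation normal form negative literals are themselves propositional variables, so only
conjunction and disjunction remain. This monotonicity makes it enough for a base language to record
which subformulas are true, and never which are false. -/
theorem peval_mono {I J : NNF Ap → Prop} (φ : NNF Ap) (h : ∀ χ ∈ patoms φ, I χ → J χ)
    (hφ : peval I φ) : peval J φ := by
  induction φ with
  | and φ ψ h₁ h₂ =>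
    exact ⟨h₁ (fun χ hχ => h χ (Or.inl hχ)) hφ.1, h₂ (fun χ hχ => h χ (Or.inr hχ)) hφ.2⟩
  | or φ ψ h₁ h₂ =>
    exact hφ.imp (h₁ fun χ hχ => h χ (Or.inl hχ)) (h₂ fun χ hχ => h χ (Or.inr hχ))
  | tt => trivial
  | ff => exact hφ
  | _ => exact h _ rfl hφ

/-- The expansion laws: a suffix satisfies `φ` iff the next one satisfies `φ` after the letter. -/
theorem sat_af (w : ℕ → Set Ap) (k : ℕ) (φ : NNF Ap) :
    Sat w (φ.af (w k)) (k + 1) ↔ Sat w φ k := by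
  induction φ with
  | tt | ff | nxt => rfl
  | pos a | npos a => by_cases h : a ∈ w k <;> simp [af, Sat, h]
  | and φ ψ h₁ h₂ => exact and_congr h₁ h₂
  | or φ ψ h₁ h₂ => exact or_congr h₁ h₂
  | ev φ ih =>
    simp only [af, Sat, ih]
    constructor
    · rintro (h | ⟨j, hj, h⟩)
      · exact ⟨k, le_rfl, h⟩
      · exact ⟨j, by omega, h⟩
    · rintro ⟨j, hj, h⟩
      rcases hj.eq_or_lt with rfl | hj
      · exact Or.inl h
      · exact Or.inr ⟨j, hj, h⟩
  | glob φ ih =>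
    simp only [af, Sat, ih]
    constructor
    · rintro ⟨h, h'⟩ j hj
      rcases hj.eq_or_lt with rfl | hj
      · exact h
      · exact h' j hj
    · exact fun h => ⟨h k le_rfl, fun j hj => h j (by omega)⟩
  | untl φ ψ h₁ h₂ =>
    simp only [af, Sat, h₁, h₂]
    constructor
    · rintro (h | ⟨h, j, hj, h', h''⟩)
      · exact ⟨k, le_rfl, h, fun i _ _ => by omega⟩
      · refine ⟨j, by omega, h', fun i hi hij => ?_⟩
        rcases hi.eq_or_lt with rfl | hi
        · exact h
        · exact h'' i hi hij
    · rintro ⟨j, hj, h, h'⟩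
      rcases hj.eq_or_lt with rfl | hj
      · exact Or.inl h
      · exact Or.inr ⟨h' k le_rfl hj, j, hj, h, fun i hi hij => h' i (by omega) hij⟩

/-- If the formulas of `T` have been guessed soundly, then `φ[T, F]` implies `φ`. -/
theorem sat_of_sat_subst {w : ℕ → Set Ap} {T F : Finset (NNF Ap)} {N : ℕ}
    (hT : ∀ ψ, glob ψ ∈ T → ∀ j ≥ N, Sat w (ψ.subst T F) j) (φ : NNF Ap) {k : ℕ} (hk : N ≤ k)
    (h : Sat w (φ.subst T F) k) : Sat w φ k := by
  induction φ generalizing k with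
  | tt | ff | pos | npos => exact h
  | and φ ψ h₁ h₂ => exact ⟨h₁ hk h.1, h₂ hk h.2⟩
  | or φ ψ h₁ h₂ => exact h.imp (h₁ hk) (h₂ hk)
  | nxt φ ih => exact ih (k := k + 1) (by omega) h
  | ev φ ih =>
    obtain ⟨j, hj, h⟩ := h
    exact ⟨j, hj, ih (hk.trans hj) h⟩
  | glob φ ih =>
    -- The induction hypothesis reduces the goal to `φ[T, F]` at `j`. If `G φ` was replaced by `tt`,
    -- this is exactly what `hT` provides, so mutual dependencies among the guessed formulas cause
    -- no circularity.
    intro j hj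
    apply ih (hk.trans hj)
    rw [subst] at h
    split_ifs at h with h₁ h₂
    · exact hT φ h₁ j (hk.trans hj)
    · exact h.elim
    · exact h j hj
  | untl φ ψ h₁ h₂ =>
    obtain ⟨j, hj, h, h'⟩ := h
    exact ⟨j, hj, h₂ (hk.trans hj) h, fun i hi hij => h₁ (hk.trans hi) (h' i hi hij)⟩

/-- If the formulas of `T` hold from `N` on and those of `F` never hold from `N` on, then `φ`
and `φ[T, F]` are equivalent from `N` on. -/
theorem sat_subst_iff {w : ℕ → Set Ap} {T F : Finset (NNF Ap)} {N : ℕ}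
    (hT : ∀ χ ∈ T, ∀ k ≥ N, Sat w χ k) (hF : ∀ χ ∈ F, ∀ k ≥ N, ¬ Sat w χ k)
    (φ : NNF Ap) {k : ℕ} (hk : N ≤ k) : Sat w (φ.subst T F) k ↔ Sat w φ k := by
  induction φ generalizing k with
  | tt | ff | pos | npos => rfl
  | and φ ψ h₁ h₂ => exact and_congr (h₁ hk) (h₂ hk)
  | or φ ψ h₁ h₂ => exact or_congr (h₁ hk) (h₂ hk)
  | nxt φ ih => exact ih (k := k + 1) (by omega)
  | ev φ ih => exact exists_congr fun j => and_congr_right fun hj => ih (hk.trans hj)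
  | glob φ ih =>
    rw [subst]
    split_ifs with h₁ h₂
    · exact iff_of_true trivial (hT _ h₁ k hk)
    · exact iff_of_false id (hF _ h₂ k hk)
    · exact forall₂_congr fun j hj => ih (hk.trans hj)
  | untl φ ψ h₁ h₂ =>
    exact exists_congr fun j => and_congr_right fun hj => and_congr (h₂ (hk.trans hj))
      (forall₃_congr fun i hi _ => h₁ (hk.trans hi))

/-! ### `G`-freeness and the formulas from which states are built -/

/-- Formulas without the operator `G`. -/
def GFree : NNF Ap → Prop
  | and φ ψ | or φ ψ | untl φ ψ => GFree φ ∧ GFree ψ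
  | nxt φ | ev φ => GFree φ
  | glob _ => False
  | _ => True

theorem gFree_subst {T F : Finset (NNF Ap)} (φ : NNF Ap)
    (h : ∀ ψ, glob ψ ∈ φ.sf → glob ψ ∈ T ∨ glob ψ ∈ F) : GFree (φ.subst T F) := by
  induction φ with
  | tt | ff | pos | npos => trivial
  | and φ ψ h₁ h₂ | or φ ψ h₁ h₂ | untl φ ψ h₁ h₂ =>
    exact ⟨h₁ fun χ hχ => h χ (by simp [sf, hχ]), h₂ fun χ hχ => h χ (by simp [sf, hχ])⟩
  | nxt φ ih | ev φ ih => exact ih fun χ hχ => h χ (by simp [sf, hχ])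
  | glob φ ih =>
    rw [subst]
    have := h φ (by simp [sf])
    split_ifs with h₁ h₂
    · trivial
    · trivial
    · tauto

theorem gFree_of_patoms (φ : NNF Ap) (h : ∀ χ ∈ patoms φ, GFree χ) : GFree φ := by
  induction φ with
  | tt | ff => trivial
  | and φ ψ h₁ h₂ | or φ ψ h₁ h₂ =>
    exact ⟨h₁ fun χ hχ => h χ (Or.inl hχ), h₂ fun χ hχ => h χ (Or.inr hχ)⟩
  | _ => exact h _ rfl

/-- Evaluation commutes with taking subformulas, except that it cuts off what lies below a replaced
`G`-formula. Hence all formulas in `𝒜_𝒢` are indexed by the subformulas of `φ` itself, which keeps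
the count at `2 ^ |sf φ|` for each `𝒢`. -/
theorem sf_subst_subset (T F : Finset (NNF Ap)) (φ : NNF Ap) :
    ((φ.subst T F).sf : Set (NNF Ap)) ⊆ subst T F '' (φ.sf : Set (NNF Ap)) := by
  induction φ with
  | tt | ff | pos | npos => simp [subst, sf]
  | and φ ψ h₁ h₂ | or φ ψ h₁ h₂ | untl φ ψ h₁ h₂ =>
    intro χ hχ
    simp only [subst, sf, Finset.coe_insert, Finset.coe_union, Set.mem_insert_iff,
      Set.mem_union] at hχ
    rcases hχ with rfl | hχ | hχ
    · exact ⟨_, self_mem_sf _, rfl⟩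
    · obtain ⟨ξ, hξ, rfl⟩ := h₁ hχ
      exact ⟨ξ, by simp_all [sf], rfl⟩
    · obtain ⟨ξ, hξ, rfl⟩ := h₂ hχ
      exact ⟨ξ, by simp_all [sf], rfl⟩
  | nxt φ ih | ev φ ih =>
    intro χ hχ
    simp only [subst, sf, Finset.coe_insert, Set.mem_insert_iff] at hχ
    rcases hχ with rfl | hχ
    · exact ⟨_, self_mem_sf _, rfl⟩
    · obtain ⟨ξ, hξ, rfl⟩ := ih hχ
      exact ⟨ξ, by simp_all [sf], rfl⟩
  | glob φ ih =>
    intro χ hχ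
    by_cases h₁ : glob φ ∈ T
    · simp only [subst, h₁, if_true, sf, Finset.coe_singleton, Set.mem_singleton_iff] at hχ
      exact ⟨glob φ, self_mem_sf _, by simp [subst, h₁, hχ]⟩
    by_cases h₂ : glob φ ∈ F
    · simp only [subst, h₁, h₂, if_true, if_false, sf, Finset.coe_singleton,
        Set.mem_singleton_iff] at hχ
      exact ⟨glob φ, self_mem_sf _, by simp [subst, h₁, h₂, hχ]⟩
    simp only [subst, h₁, h₂, if_false, sf, Finset.coe_insert, Set.mem_insert_iff] at hχ
    rcases hχ with rfl | hχ
    · exact ⟨glob φ, self_mem_sf _, by simp [subst, h₁, h₂]⟩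
    · obtain ⟨ξ, hξ, rfl⟩ := ih hχ
      exact ⟨ξ, by simp_all [sf], rfl⟩

theorem patoms_subst_subset {T F : Finset (NNF Ap)} {φ χ : NNF Ap}
    (h : patoms χ ⊆ (φ.sf : Set (NNF Ap))) :
    patoms (χ.subst T F) ⊆ subst T F '' (φ.sf : Set (NNF Ap)) := by
  induction χ with
  | tt | ff => simp [subst, patoms]
  | and χ₁ χ₂ h₁ h₂ | or χ₁ χ₂ h₁ h₂ =>
    have h' := Set.union_subset_iff.1 h
    exact Set.union_subset (h₁ h'.1) (h₂ h'.2)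
  | _ =>
    exact (patoms_subset_sf _).trans ((sf_subst_subset T F _).trans
      (Set.image_mono (Finset.coe_subset.2 (sf_trans (h rfl)))))

/-- `af` unfolds a variable into a combination of its own subformulas, so a subformula-closed set of
variables is never left. -/
theorem patoms_af_subset_of_closed {S : Set (NNF Ap)} (hS : ∀ χ ∈ S, (χ.sf : Set (NNF Ap)) ⊆ S)
    {χ : NNF Ap} (h : patoms χ ⊆ S) (ν : Set Ap) : patoms (χ.af ν) ⊆ S := by
  induction χ with
  | and χ₁ χ₂ h₁ h₂ | or χ₁ χ₂ h₁ h₂ =>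
    have h' := Set.union_subset_iff.1 h
    exact Set.union_subset (h₁ h'.1) (h₂ h'.2)
  | tt | ff => simp [af, patoms]
  | _ => exact (patoms_af_sf _ ν).trans (hS _ (h rfl))

/-- The formulas `χ[𝒢]` for the subformulas `χ` of `φ`. -/
def GSet.evalSf {φ : NNF Ap} (𝒢 : φ.GSet) : Set (NNF Ap) := 𝒢.eval '' (φ.sf : Set (NNF Ap))

theorem GSet.sf_subset_evalSf {φ : NNF Ap} (𝒢 : φ.GSet) :
    ∀ χ ∈ 𝒢.evalSf, (χ.sf : Set (NNF Ap)) ⊆ 𝒢.evalSf := by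
  rintro _ ⟨χ, hχ, rfl⟩
  exact (sf_subst_subset _ _ χ).trans (Set.image_mono (Finset.coe_subset.2 (sf_trans hχ)))

theorem GSet.gFree_of_mem_evalSf {φ : NNF Ap} (𝒢 : φ.GSet) : ∀ χ ∈ 𝒢.evalSf, GFree χ := by
  classical
  rintro _ ⟨χ, hχ, rfl⟩
  refine gFree_subst χ fun ψ hψ => ?_
  have : glob ψ ∈ φ.gsf := Finset.mem_filter.2 ⟨sf_trans hχ hψ, ψ, rfl⟩
  by_cases h : glob ψ ∈ 𝒢.1
  · exact Or.inl h
  · exact Or.inr (Finset.mem_sdiff.2 ⟨this, h⟩)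

theorem af_mem_boolComb_of_closed {S : Set (NNF Ap)}
    (hS : ∀ χ ∈ S, (χ.sf : Set (NNF Ap)) ⊆ S) {c : PClass Ap} (h : c ∈ boolComb S) (ν : Set Ap) :
    c.af ν ∈ boolComb S := by
  obtain ⟨χ, rfl, hχ⟩ := h
  exact ⟨χ.af ν, rfl, patoms_af_subset_of_closed hS hχ ν⟩

theorem tt_mem_boolComb (S : Set (NNF Ap)) : PClass.mk tt ∈ boolComb S :=
  ⟨tt, rfl, by simp [patoms]⟩

theorem reach_subset_boolComb {S : Set (NNF Ap)} (hS : ∀ χ ∈ S, (χ.sf : Set (NNF Ap)) ⊆ S)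
    {c : PClass Ap} (hc : c ∈ boolComb S) : c.reach ⊆ boolComb S := by
  rintro _ ⟨w, rfl⟩
  induction w using List.reverseRecOn with
  | nil => exact hc
  | append_singleton w ν ih => rw [List.foldl_append]; exact af_mem_boolComb_of_closed hS ih ν

theorem reach_subset_boolComb_sf (φ : NNF Ap) :
    (PClass.mk φ).reach ⊆ boolComb (φ.sf : Set (NNF Ap)) :=
  reach_subset_boolComb (fun _ h => Finset.coe_subset.2 (sf_trans h)) (self_mem_boolComb φ)

theorem monStates_subset_boolComb (φ : NNF Ap) (𝒢 : φ.GSet) :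
    φ.monStates 𝒢 ⊆ boolComb 𝒢.evalSf := by
  rintro c ⟨φ', h₁, h₂⟩
  obtain ⟨χ, rfl, hχ⟩ := reach_subset_boolComb_sf φ h₁
  exact reach_subset_boolComb 𝒢.sf_subset_evalSf ⟨_, rfl, patoms_subst_subset hχ⟩ h₂

theorem bpStates_subset_boolComb {φ : NNF Ap} (𝒢 : φ.GSet) {ψ : NNF Ap} (hψ : glob ψ ∈ 𝒢.1) :
    bpStates (𝒢.eval ψ) ⊆ boolComb 𝒢.evalSf ×ˢ boolComb 𝒢.evalSf := by
  classical
  have hψ' : ψ ∈ φ.sf :=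
    sf_trans (Finset.mem_filter.1 (𝒢.2 hψ)).1 (by simp [sf, self_mem_sf])
  have h₀ : PClass.mk (𝒢.eval ψ) ∈ boolComb 𝒢.evalSf :=
    ⟨_, rfl, (patoms_subset_sf _).trans (𝒢.sf_subset_evalSf _ ⟨ψ, hψ', rfl⟩)⟩
  rintro _ ⟨w, rfl⟩
  induction w using List.reverseRecOn with
  | nil => exact ⟨h₀, tt_mem_boolComb _⟩
  | append_singleton w ν ih =>
    rw [List.foldl_append, List.foldl_cons, List.foldl_nil, bpStep]
    have h₂ := and_mem_boolComb (af_mem_boolComb_of_closed 𝒢.sf_subset_evalSf ih.2 ν) h₀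
    split
    · exact ⟨h₂, tt_mem_boolComb _⟩
    · exact ⟨af_mem_boolComb_of_closed 𝒢.sf_subset_evalSf ih.1 ν, h₂⟩

end NNF

/-! ### Linear size of the negation normal form -/

section Size

open Classical in
/-- The formulas that the negation normal form introduces for `φ` and its negation. -/
noncomputable def LTL.nnfParts {Ap : Type u} (φ : LTL Ap) : Finset (NNF Ap) :=
  {φ.nnfPol true, φ.nnfPol false} ∪
    match φ with
    | .untl φ ψ => {.untl (ψ.nnfPol false) (.and (φ.nnfPol false) (ψ.nnfPol false)),
        .and (φ.nnfPol false) (ψ.nnfPol false), .glob (ψ.nnfPol false)}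
    | _ => ∅

theorem LTL.card_nnfParts_le {Ap : Type u} (φ : LTL Ap) : φ.nnfParts.card ≤ 5 := by
  classical
  refine (Finset.card_union_le _ _).trans (Nat.add_le_add (d := 3) Finset.card_le_two ?_)
  cases φ <;> first | exact Nat.zero_le _ | exact Finset.card_le_three

theorem LTL.nnfPol_mem_nnfParts {Ap : Type u} (φ : LTL Ap) (b : Bool) :
    φ.nnfPol b ∈ φ.nnfParts := by
  cases b <;> simp [LTL.nnfParts]

/-- Each subformula of `φ` contributes only its two polarities and, for an until, the three
auxiliary formulas of its negation. The ambient set `X` is kept fixed so that the hypothesis passes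
to subformulas in the induction. -/
theorem LTL.sf_nnfPol_subset {Ap : Type u} (X : Finset (NNF Ap)) (φ : LTL Ap)
    (h : ∀ θ ∈ φ.sf, θ.nnfParts ⊆ X) (b : Bool) : (φ.nnfPol b).sf ⊆ X := by
  classical
  have hφ : φ.nnfParts ⊆ X := h φ (by cases φ <;> simp [LTL.sf])
  have h₀ := hφ (φ.nnfPol_mem_nnfParts b)
  induction φ generalizing b with
  | tt | ff | atom =>
    cases b <;> simpa only [LTL.nnfPol, NNF.sf, Finset.singleton_subset_iff] using h₀
  | neg φ ih =>
    have hφ : φ.nnfParts ⊆ X := h φ (by cases φ <;> simp [LTL.sf])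
    have ih b := ih (fun θ hθ => h θ (by simp [LTL.sf, hθ])) b hφ
      (hφ (φ.nnfPol_mem_nnfParts b))
    cases b <;> exact ih _
  | nxt φ ih | ev φ ih | glob φ ih =>
    have hφ : φ.nnfParts ⊆ X := h φ (by cases φ <;> simp [LTL.sf])
    have ih b := ih (fun θ hθ => h θ (by simp [LTL.sf, hθ])) b hφ
      (hφ (φ.nnfPol_mem_nnfParts b))
    cases b <;> exact Finset.insert_subset h₀ (ih _)
  | and φ ψ ih₁ ih₂ | or φ ψ ih₁ ih₂ =>
    have h₁ : φ.nnfParts ⊆ X := h φ (by cases φ <;> simp [LTL.sf])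
    have h₂ : ψ.nnfParts ⊆ X := h ψ (by cases ψ <;> simp [LTL.sf])
    have ih₁ b := ih₁ (fun θ hθ => h θ (by simp [LTL.sf, hθ])) b h₁
      (h₁ (φ.nnfPol_mem_nnfParts b))
    have ih₂ b := ih₂ (fun θ hθ => h θ (by simp [LTL.sf, hθ])) b h₂
      (h₂ (ψ.nnfPol_mem_nnfParts b))
    cases b <;> exact Finset.insert_subset h₀ (Finset.union_subset (ih₁ _) (ih₂ _))
  | untl φ ψ ih₁ ih₂ =>
    have h₁ : φ.nnfParts ⊆ X := h φ (by cases φ <;> simp [LTL.sf])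
    have h₂ : ψ.nnfParts ⊆ X := h ψ (by cases ψ <;> simp [LTL.sf])
    have ih₁ b := ih₁ (fun θ hθ => h θ (by simp [LTL.sf, hθ])) b h₁
      (h₁ (φ.nnfPol_mem_nnfParts b))
    have ih₂ b := ih₂ (fun θ hθ => h θ (by simp [LTL.sf, hθ])) b h₂
      (h₂ (ψ.nnfPol_mem_nnfParts b))
    cases b
    · simp only [LTL.nnfParts, Finset.union_subset_iff, Finset.insert_subset_iff,
        Finset.singleton_subset_iff] at hφ
      simp only [LTL.nnfPol, NNF.sf, Finset.union_subset_iff, Finset.insert_subset_iff]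
      exact ⟨hφ.1.2, ⟨hφ.2.1, ih₂ _, hφ.2.2.1, ih₁ _, ih₂ _⟩, hφ.2.2.2, ih₂ _⟩
    · exact Finset.insert_subset h₀ (Finset.union_subset (ih₁ _) (ih₂ _))

theorem LTL.card_sf_nnf_le {Ap : Type u} (φ : LTL Ap) : φ.nnf.sf.card ≤ 5 * φ.size := by
  classical
  refine (Finset.card_le_card (φ.sf_nnfPol_subset (φ.sf.biUnion LTL.nnfParts)
    (fun θ hθ => Finset.subset_biUnion_of_mem _ hθ) true)).trans ?_
  rw [mul_comm]
  exact Finset.card_biUnion_le_card_mul _ _ _ fun χ _ => χ.card_nnfParts_le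

end Size

/-! ### Truth of `G`-free formulas is witnessed by a finite prefix -/

namespace NNF

variable {Ap : Type u}

/-- The formula after the letters of `w` at `n` positions from `k` on. -/
noncomputable def afIter (w : ℕ → Set Ap) : NNF Ap → ℕ → ℕ → NNF Ap
  | φ, _, 0 => φ
  | φ, k, n + 1 => afIter w (φ.af (w k)) (k + 1) n

theorem afIter_succ (w : ℕ → Set Ap) (φ : NNF Ap) (k n : ℕ) :
    afIter w φ k (n + 1) = (afIter w φ k n).af (w (k + n)) := by
  induction n generalizing φ k with
  | zero => rfl
  | succ n ih =>
    rw [afIter, ih, afIter]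
    congr 2
    omega

theorem afIter_and (w : ℕ → Set Ap) (φ ψ : NNF Ap) (k n : ℕ) :
    afIter w (and φ ψ) k n = and (afIter w φ k n) (afIter w ψ k n) := by
  induction n generalizing φ ψ k with
  | zero => rfl
  | succ n ih => exact ih _ _ _

theorem afIter_or (w : ℕ → Set Ap) (φ ψ : NNF Ap) (k n : ℕ) :
    afIter w (or φ ψ) k n = or (afIter w φ k n) (afIter w ψ k n) := by
  induction n generalizing φ ψ k with
  | zero => rfl
  | succ n ih => exact ih _ _ _

/-- After reading the letters from position `k` on, `φ` eventually becomes true. -/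
def EvTrue (w : ℕ → Set Ap) (φ : NNF Ap) (k : ℕ) : Prop :=
  ∃ m, ∀ n ≥ m, ∀ I, peval I (afIter w φ k n)

theorem evTrue_tt (w : ℕ → Set Ap) (k : ℕ) : EvTrue w tt k := by
  refine ⟨0, fun n _ I => ?_⟩
  clear * -
  induction n generalizing k with
  | zero => trivial
  | succ n ih => exact ih (k + 1)

theorem EvTrue.of_af {w : ℕ → Set Ap} {φ : NNF Ap} {k : ℕ} (h : EvTrue w (φ.af (w k)) (k + 1)) :
    EvTrue w φ k := by
  obtain ⟨m, h⟩ := h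
  refine ⟨m + 1, fun n hn I => ?_⟩
  obtain ⟨n, rfl⟩ : ∃ n', n = n' + 1 := ⟨n - 1, by omega⟩
  exact h n (by omega) I

theorem EvTrue.af {w : ℕ → Set Ap} {φ : NNF Ap} {k : ℕ} (h : EvTrue w φ k) :
    EvTrue w (φ.af (w k)) (k + 1) := by
  obtain ⟨m, h⟩ := h
  exact ⟨m, fun n hn I => h (n + 1) (by omega) I⟩

theorem EvTrue.and {w : ℕ → Set Ap} {φ ψ : NNF Ap} {k : ℕ} (hφ : EvTrue w φ k)
    (hψ : EvTrue w ψ k) : EvTrue w (and φ ψ) k := by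
  obtain ⟨m, h⟩ := hφ
  obtain ⟨m', h'⟩ := hψ
  refine ⟨max m m', fun n hn I => ?_⟩
  rw [afIter_and]
  exact ⟨h n (by omega) I, h' n (by omega) I⟩

theorem EvTrue.or_left {w : ℕ → Set Ap} {φ : NNF Ap} (ψ : NNF Ap) {k : ℕ} (hφ : EvTrue w φ k) :
    EvTrue w (or φ ψ) k := by
  obtain ⟨m, h⟩ := hφ
  refine ⟨m, fun n hn I => ?_⟩
  rw [afIter_or]
  exact Or.inl (h n hn I)

theorem EvTrue.or_right {w : ℕ → Set Ap} (φ : NNF Ap) {ψ : NNF Ap} {k : ℕ} (hψ : EvTrue w ψ k) :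
    EvTrue w (or φ ψ) k := by
  obtain ⟨m, h⟩ := hψ
  refine ⟨m, fun n hn I => ?_⟩
  rw [afIter_or]
  exact Or.inr (h n hn I)

/-- Without `G`, every operator has a witness at a finite distance. For `F` and `U` an inner
induction on the distance to the witness unfolds the formula letter by letter, and the relevant
disjunct becomes `tt`. -/
theorem GFree.evTrue {w : ℕ → Set Ap} {φ : NNF Ap} (hφ : GFree φ) {k : ℕ} (h : Sat w φ k) :
    EvTrue w φ k := by
  induction φ generalizing k with
  | tt => exact evTrue_tt w k
  | ff => exact h.elim
  | pos a =>
    apply EvTrue.of_af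
    rw [NNF.af, if_pos (show a ∈ w k from h)]
    exact evTrue_tt w _
  | npos a =>
    apply EvTrue.of_af
    rw [NNF.af, if_neg (show a ∉ w k from h)]
    exact evTrue_tt w _
  | and φ ψ h₁ h₂ => exact (h₁ hφ.1 h.1).and (h₂ hφ.2 h.2)
  | or φ ψ h₁ h₂ =>
    rcases h with h | h
    · exact (h₁ hφ.1 h).or_left _
    · exact (h₂ hφ.2 h).or_right _
  | nxt φ ih => exact EvTrue.of_af (ih hφ (k := k + 1) h)
  | ev φ ih =>
    obtain ⟨j, hj, h⟩ := h
    obtain ⟨d, rfl⟩ := Nat.exists_eq_add_of_le hj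
    clear hj
    induction d generalizing k with
    | zero => exact EvTrue.of_af ((ih hφ h).af.or_left _)
    | succ d ih' =>
      exact EvTrue.of_af ((ih' (k := k + 1) (by rwa [Nat.add_right_comm])).or_right _)
  | glob φ ih => exact hφ.elim
  | untl φ ψ h₁ h₂ =>
    obtain ⟨j, hj, h, h'⟩ := h
    obtain ⟨d, rfl⟩ := Nat.exists_eq_add_of_le hj
    clear hj
    induction d generalizing k with
    | zero => exact EvTrue.of_af ((h₂ hφ.2 h).af.or_left _)
    | succ d ih' =>
      refine EvTrue.of_af (EvTrue.or_right _ (EvTrue.and ?_ (ih' (k := k + 1) ?_ ?_)))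
      · exact (h₁ hφ.1 (h' k le_rfl (by omega))).af
      · rwa [Nat.add_right_comm]
      · exact fun i hi hij => h' i (by omega) (by omega)

end NNF

/-! ### Satisfaction of classes and runs of `af` -/

namespace PClass

variable {Ap : Type u}

open NNF

theorem mk_eq_tt_iff {φ : NNF Ap} : mk φ = mk tt ↔ ∀ I, peval I φ := by
  refine ⟨fun h I => ?_, fun h => Quotient.sound (s := propSetoid Ap) fun I => ?_⟩
  · exact (Quotient.exact (s := propSetoid Ap) h I).2 trivial
  · exact iff_of_true (h I) trivial

/-- The suffix of `w` from `k` on satisfies the formulas of the class. -/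
def Sat (w : ℕ → Set Ap) (c : PClass Ap) (k : ℕ) : Prop :=
  Quotient.lift (s := propSetoid Ap) (fun φ => NNF.Sat w φ k)
    (fun φ ψ h => by rw [← peval_sat, ← peval_sat w k ψ]; exact propext (h _)) c

theorem sat_mk {w : ℕ → Set Ap} {φ : NNF Ap} {k : ℕ} : Sat w (mk φ) k ↔ NNF.Sat w φ k := Iff.rfl

theorem sat_tt {w : ℕ → Set Ap} {k : ℕ} : Sat w (mk tt) k := trivial

theorem sat_af {w : ℕ → Set Ap} {c : PClass Ap} {k : ℕ} :
    Sat w (c.af (w k)) (k + 1) ↔ Sat w c k := by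
  obtain ⟨φ, rfl⟩ := (Quotient.exists_rep c : ∃ φ, mk φ = c)
  exact NNF.sat_af w k φ

theorem sat_and {w : ℕ → Set Ap} {c d : PClass Ap} {k : ℕ} :
    Sat w (c.and d) k ↔ Sat w c k ∧ Sat w d k := by
  obtain ⟨φ, rfl⟩ := (Quotient.exists_rep c : ∃ φ, mk φ = c)
  obtain ⟨ψ, rfl⟩ := (Quotient.exists_rep d : ∃ φ, mk φ = d)
  exact Iff.rfl

theorem sat_of_eq_tt {w : ℕ → Set Ap} {C : ℕ → PClass Ap} {k n : ℕ}
    (hC : ∀ n ≥ k, C (n + 1) = (C n).af (w n)) (hn : k ≤ n) (h : C n = mk tt) : Sat w (C k) k := by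
  have h' : Sat w (C n) n := h ▸ sat_tt
  clear h
  induction n, hn using Nat.le_induction with
  | base => exact h'
  | succ n hn ih => exact ih (by rw [hC n hn] at h'; exact sat_af.1 h')

/-- A representative with variables in `S` is `G`-free, even if other members of its class are not;
`GFree.evTrue` applies to that representative. -/
theorem eventually_eq_tt {w : ℕ → Set Ap} {C : ℕ → PClass Ap} {k : ℕ} {S : Set (NNF Ap)}
    (hS : ∀ χ ∈ S, GFree χ) (hk : C k ∈ boolComb S)
    (hC : ∀ n ≥ k, C (n + 1) = (C n).af (w n)) (h : Sat w (C k) k) :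
    ∀ᶠ n in Filter.atTop, C n = mk tt := by
  obtain ⟨φ, hφ, hφS⟩ := hk
  have hφG : GFree φ := gFree_of_patoms φ fun χ hχ => hS χ (hφS hχ)
  rw [hφ] at h
  obtain ⟨m, hm⟩ := hφG.evTrue h
  have key : ∀ n, C (k + n) = mk (afIter w φ k n) := by
    intro n
    induction n with
    | zero => exact hφ
    | succ n ih => rw [← add_assoc, hC _ (by omega), ih, afIter_succ]; rfl
  refine Filter.eventually_atTop.2 ⟨k + m, fun n hn => ?_⟩
  obtain ⟨d, rfl⟩ : ∃ d, n = k + d := ⟨n - k, by omega⟩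
  rw [key]
  exact mk_eq_tt_iff.2 (hm d (by omega))

end PClass

/-! ### Breakpoint monitors -/

namespace NNF

variable {Ap : Type u}

/-- The language of a state of the breakpoint monitor for `G ψ`. -/
def BPSat (w : ℕ → Set Ap) (ψ : NNF Ap) (p : PClass Ap × PClass Ap) (k : ℕ) : Prop :=
  p.1.Sat w k ∧ p.2.Sat w k ∧ ∀ j > k, Sat w ψ j

/-- Reading a letter moves the obligation `ψ` at position `k + 1` out of the `X G` part and into the
pair. At a breakpoint `ξ₁` is dropped, which loses nothing, since `af ξ₁ ≡ tt` already makes it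
true. -/
theorem bpSat_bpStep {w : ℕ → Set Ap} {ψ : NNF Ap} {p : PClass Ap × PClass Ap} {k : ℕ} :
    BPSat w ψ (bpStep ψ p (w k)) (k + 1) ↔ BPSat w ψ p k := by
  have hG : (∀ j > k, Sat w ψ j) ↔ Sat w ψ (k + 1) ∧ ∀ j > k + 1, Sat w ψ j := by
    refine ⟨fun h => ⟨h _ (by omega), fun j hj => h j (by omega)⟩, fun ⟨h, h'⟩ j hj => ?_⟩
    rcases (Nat.succ_le_of_lt hj).eq_or_lt with rfl | hj
    · exact h
    · exact h' j hj
  rw [BPSat, BPSat, hG, bpStep]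
  split_ifs with h
  · have h₁ : p.1.Sat w k := PClass.sat_af.1 (h ▸ PClass.sat_tt)
    simp only [PClass.sat_and, PClass.sat_af, PClass.sat_mk, h₁]
    simp only [Sat]
    tauto
  · simp only [PClass.sat_and, PClass.sat_af, PClass.sat_mk]
    tauto

/-- Breakpoints recur exactly when every obligation collected by the monitor is eventually
discharged. `G`-freeness is what turns truth of the obligations into breakpoints. -/
theorem frequently_breakpoint_iff {w : ℕ → Set Ap} {ψ : NNF Ap} {P : ℕ → PClass Ap × PClass Ap}
    {k : ℕ} {S : Set (NNF Ap)} (hS : ∀ χ ∈ S, GFree χ) (hPS : ∀ n, (P n).1 ∈ boolComb S)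
    (hP : ∀ n ≥ k, P (n + 1) = bpStep ψ (P n) (w n)) :
    (∃ᶠ n in Filter.atTop, (P n).1.af (w n) = PClass.mk tt) ↔ BPSat w ψ (P k) k := by
  constructor
  · intro h
    rw [Filter.frequently_atTop] at h
    -- Induction on the distance to a later breakpoint: there `ξ₁` has become `tt`, and between
    -- breakpoints `ξ₁` evolves by `af` alone, so truth pulls back.
    have h₁ : ∀ n ≥ k, (P n).1.Sat w n := by
      intro n hn
      obtain ⟨m, hm, h⟩ := h n
      obtain ⟨d, rfl⟩ := Nat.exists_eq_add_of_le hm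
      clear hm
      induction d generalizing n with
      | zero => exact PClass.sat_af.1 (h ▸ PClass.sat_tt)
      | succ d ih =>
        by_cases hb : (P n).1.af (w n) = PClass.mk tt
        · exact PClass.sat_af.1 (hb ▸ PClass.sat_tt)
        · have := ih (n + 1) (by omega) (by rwa [Nat.add_assoc, Nat.add_comm 1])
          rw [hP n hn, bpStep, if_neg hb] at this
          exact PClass.sat_af.1 this
    -- At a breakpoint the next first component is `af ξ₂ ∧ ψ`, which is true by `h₁`. Elsewhere the
    -- same conjunction is the next second component, and the claim is pulled back from the later
    -- breakpoint.
    have h₂ : ∀ n ≥ k, (P n).2.Sat w n ∧ Sat w ψ (n + 1) := by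
      intro n hn
      obtain ⟨m, hm, h⟩ := h n
      obtain ⟨d, rfl⟩ := Nat.exists_eq_add_of_le hm
      clear hm
      have breakpoint : ∀ n ≥ k, (P n).1.af (w n) = PClass.mk tt →
          (P n).2.Sat w n ∧ Sat w ψ (n + 1) := by
        intro n hn hb
        have := h₁ (n + 1) (by omega)
        rw [hP n hn, bpStep, if_pos hb, PClass.sat_and, PClass.sat_af] at this
        exact this
      induction d generalizing n with
      | zero => exact breakpoint n hn h
      | succ d ih =>
        by_cases hb : (P n).1.af (w n) = PClass.mk tt
        · exact breakpoint n hn hb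
        · have := (ih (n + 1) (by omega) (by rwa [Nat.add_assoc, Nat.add_comm 1])).1
          rw [hP n hn, bpStep, if_neg hb, PClass.sat_and, PClass.sat_af] at this
          exact this
    refine ⟨h₁ k le_rfl, (h₂ k le_rfl).1, fun j hj => ?_⟩
    obtain ⟨j, rfl⟩ : ∃ j', j = j' + 1 := ⟨j - 1, by omega⟩
    exact (h₂ j (by omega)).2
  · intro h
    have h' : ∀ n ≥ k, BPSat w ψ (P n) n := by
      intro n hn
      induction n, hn using Nat.le_induction with
      | base => exact h
      | succ n hn ih => rw [hP n hn]; exact bpSat_bpStep.2 ih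
    -- With no breakpoint after `N`, the first component would evolve by `af` alone. Being true and
    -- `G`-free it would become `tt`, and the next letter would then be a breakpoint.
    by_contra hne
    rw [Filter.not_frequently, Filter.eventually_atTop] at hne
    obtain ⟨N, hN⟩ := hne
    have hC : ∀ n ≥ max N k, (P (n + 1)).1 = (P n).1.af (w n) := by
      intro n hn
      rw [hP n (by omega), bpStep, if_neg (hN n (by omega))]
    obtain ⟨n, hn, hn'⟩ := ((PClass.eventually_eq_tt (C := fun n => (P n).1) hS (hPS _) hC
      (h' _ (le_max_right _ _)).1).and (Filter.eventually_ge_atTop N)).exists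
    exact hN n hn' (by rw [hn]; rfl)

end NNF

/-! ### Semantic description of the languages of states -/

namespace NNF

variable {Ap : Type u}

/-- The language of a state of the subcomponent for `𝒢`. -/
def CompState.Sat (w : ℕ → Set Ap) {φ : NNF Ap} {𝒢 : φ.GSet} (s : φ.CompState 𝒢) (k : ℕ) : Prop :=
  s.1.1.Sat w k ∧ ∀ i, BPSat w (𝒢.eval i.1) (s.2 i).1 k

theorem CompState.sat_step {w : ℕ → Set Ap} {φ : NNF Ap} {𝒢 : φ.GSet} {s : φ.CompState 𝒢}
    {k : ℕ} : (s.step (w k)).Sat w (k + 1) ↔ s.Sat w k :=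
  and_congr PClass.sat_af (forall_congr' fun _ => bpSat_bpStep)

/-- The class `χ` is eventually `tt` for good once it is true, so requiring `χ ≡ tt` at the
breakpoints costs nothing, and the condition splits into one for `χ` and one for each breakpoint
monitor. -/
theorem frequently_accTrans_iff {w : ℕ → Set Ap} {φ : NNF Ap} {𝒢 : φ.GSet}
    {σ : ℕ → φ.CompState 𝒢} {k : ℕ} (hσ : ∀ n ≥ k, σ (n + 1) = (σ n).step (w n)) :
    (∀ i, ∃ᶠ n in Filter.atTop,
      ((.inr ⟨𝒢, σ n⟩, w n, .inr ⟨𝒢, (σ n).step (w n)⟩) : φ.AState × Set Ap × φ.AState) ∈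
        φ.accTrans i) ↔ (σ k).Sat w k := by
  have hmem : ∀ i n, ((.inr ⟨𝒢, σ n⟩, w n, .inr ⟨𝒢, (σ n).step (w n)⟩) :
      φ.AState × Set Ap × φ.AState) ∈ φ.accTrans i ↔ (σ n).1.1 = PClass.mk tt ∧
        ∀ ψ ∈ i, ∀ h : glob ψ.1 ∈ 𝒢.1, ((σ n).2 ⟨ψ.1, h⟩).1.1.af (w n) = PClass.mk tt := by
    intro i n
    constructor
    · rintro ⟨𝒢', s, ν, h, h'⟩
      simp only [Prod.mk.injEq, Sum.inr.injEq, Sigma.mk.injEq] at h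
      obtain ⟨⟨rfl, h₁⟩, rfl, -⟩ := h
      obtain rfl := eq_of_heq h₁
      exact h'
    · exact fun h => ⟨𝒢, σ n, w n, rfl, h⟩
  simp only [hmem]
  have hC : ∀ n ≥ k, (σ (n + 1)).1.1 = (σ n).1.1.af (w n) := fun n hn => by rw [hσ n hn]; rfl
  have hBP : ∀ i, (∃ᶠ n in Filter.atTop, ((σ n).2 i).1.1.af (w n) = PClass.mk tt) ↔
      BPSat w (𝒢.eval i.1) ((σ k).2 i).1 k := fun i =>
    frequently_breakpoint_iff (P := fun n => ((σ n).2 i).1) 𝒢.gFree_of_mem_evalSf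
      (fun n => (bpStates_subset_boolComb 𝒢 i.2 ((σ n).2 i).2).1)
      (fun n hn => by rw [hσ n hn]; rfl)
  constructor
  · intro h
    constructor
    · obtain ⟨n, hn, hk⟩ := ((h none).and_eventually (Filter.eventually_ge_atTop k)).exists
      exact PClass.sat_of_eq_tt (C := fun n => (σ n).1.1) hC hk hn.1
    · intro i
      rw [← hBP]
      exact (h (some ⟨i.1, 𝒢.2 i.2⟩)).mono fun n hn => hn.2 _ rfl i.2
  · rintro ⟨h₁, h₂⟩ i
    have hev := PClass.eventually_eq_tt (C := fun n => (σ n).1.1) 𝒢.gFree_of_mem_evalSf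
      (monStates_subset_boolComb φ 𝒢 (σ k).1.2) hC h₁
    by_cases hi : ∃ ψ ∈ i, glob ψ.1 ∈ 𝒢.1
    · obtain ⟨ψ, hψ, h⟩ := hi
      refine (((hBP ⟨ψ.1, h⟩).2 (h₂ _)).and_eventually hev).mono fun n hn => ⟨hn.2, ?_⟩
      intro ψ' hψ' h'
      obtain rfl := Option.mem_unique hψ hψ'
      exact hn.1
    -- Here `i` is `none` or names a formula outside `𝒢`, so only the condition on `χ` is left.
    · exact hev.frequently.mono fun n hn => ⟨hn, fun ψ hψ h => absurd ⟨ψ, hψ, h⟩ hi⟩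

/-- The language of a state of the automaton. -/
def AState.Sat (w : ℕ → Set Ap) {φ : NNF Ap} : φ.AState → ℕ → Prop
  | .inl c, k => c.1.Sat w k
  | .inr ⟨_, s⟩, k => s.Sat w k

theorem AState.sat_step {w : ℕ → Set Ap} {φ : NNF Ap} {q : φ.AState} {k : ℕ} :
    (q.step (w k)).Sat w (k + 1) ↔ q.Sat w k := by
  rcases q with c | ⟨𝒢, s⟩
  · exact PClass.sat_af
  · exact CompState.sat_step

/-- The initial pair `(ψ[𝒢], tt)` covers the current position and the `X G` part all later ones.
Together they say that the guess `𝒢` is sound from `k` on. -/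
theorem sat_of_sat_jump {w : ℕ → Set Ap} {φ : NNF Ap} {c : (PClass.mk φ).reach} {𝒢 : φ.GSet}
    {k : ℕ} (h : (jump c 𝒢).Sat w k) : c.1.Sat w k := by
  obtain ⟨χ, hχ⟩ := (Quotient.exists_rep c.1 : ∃ φ, PClass.mk φ = c.1)
  have h₁ : (𝒢.evalClass c.1).Sat w k := h.1
  rw [← hχ] at h₁ ⊢
  refine sat_of_sat_subst (fun ψ hψ j hj => ?_) χ le_rfl h₁
  have h₂ := h.2 ⟨ψ, hψ⟩
  rcases hj.eq_or_lt with rfl | hj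
  · exact h₂.1
  · exact h₂.2.2 j hj

theorem exists_sat_jump {w : ℕ → Set Ap} (φ : NNF Ap) :
    ∃ (𝒢 : φ.GSet) (k : ℕ), ∀ c : (PClass.mk φ).reach, c.1.Sat w k → (jump c 𝒢).Sat w k := by
  classical
  -- A `G`-formula that holds once holds forever after. So the members of `T` hold from a common
  -- position on, and the other `G`-subformulas hold nowhere. The choice depends only on the word,
  -- not on the state from which the jump is made.
  let T := φ.gsf.filter fun χ => ∃ n, Sat w χ n
  have hev : ∀ᶠ k in Filter.atTop, ∀ χ ∈ T, Sat w χ k := by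
    rw [Filter.eventually_all_finset]
    intro χ hχ
    obtain ⟨hχ, n, hn⟩ := Finset.mem_filter.1 hχ
    obtain ⟨-, ψ, rfl⟩ := Finset.mem_filter.1 hχ
    exact Filter.eventually_atTop.2 ⟨n, fun k hk j hj => hn j (hk.trans hj)⟩
  obtain ⟨k, hk⟩ := Filter.eventually_atTop.1 hev
  refine ⟨⟨T, Finset.filter_subset _ _⟩, k, fun c hc => ?_⟩
  have key : ∀ χ j, k ≤ j → (Sat w (GSet.eval (φ := φ) ⟨T, Finset.filter_subset _ _⟩ χ) j ↔
      Sat w χ j) := fun χ j hj =>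
    sat_subst_iff (fun χ hχ j hj => hk j hj χ hχ) (fun χ hχ j hj h => by
      rw [Finset.mem_sdiff] at hχ
      exact hχ.2 (Finset.mem_filter.2 ⟨hχ.1, j, h⟩)) χ hj
  obtain ⟨χ, hχ⟩ := (Quotient.exists_rep c.1 : ∃ φ, PClass.mk φ = c.1)
  constructor
  · change (GSet.evalClass _ c.1).Sat w k
    rw [← hχ] at hc ⊢
    exact (key χ k le_rfl).2 hc
  · rintro ⟨ψ, hψ⟩
    have hglob : Sat w (glob ψ) k := hk k le_rfl _ hψ
    exact ⟨(key ψ k le_rfl).2 (hglob k le_rfl), trivial,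
      fun j hj => (key ψ j hj.le).2 (hglob j hj.le)⟩

theorem sat_of_reflTransGen_ε {w : ℕ → Set Ap} {φ : NNF Ap} {q q' : φ.AState} {k : ℕ}
    (h : Relation.ReflTransGen φ.ldba.ε q q') (hq' : q'.Sat w k) : q.Sat w k := by
  induction h using Relation.ReflTransGen.head_induction_on with
  | refl => exact hq'
  | head h _ ih =>
    obtain ⟨c, 𝒢, rfl, rfl⟩ := h
    exact sat_of_sat_jump ih

theorem eq_of_reflTransGen_ε {φ : NNF Ap} {s : Σ 𝒢 : φ.GSet, φ.CompState 𝒢} {q : φ.AState}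
    (h : Relation.ReflTransGen φ.ldba.ε (.inr s) q) : q = .inr s := by
  rcases Relation.ReflTransGen.cases_head h with h | ⟨q', ⟨c, 𝒢, h, -⟩, -⟩
  · exact h.symm
  · cases h

/-- The `ε`-transition for `𝒢`, where there is one. -/
noncomputable def AState.enter {φ : NNF Ap} (𝒢 : φ.GSet) : φ.AState → φ.AState
  | .inl c => .inr ⟨𝒢, jump c 𝒢⟩
  | .inr s => .inr s

theorem mem_lang_iff {φ : NNF Ap} {q : φ.AState} {w : ℕ → Set Ap} :
    w ∈ φ.ldba.lang q ↔ q.Sat w 0 := by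
  constructor
  · rintro ⟨ρ, π, h₀, hrun, hacc⟩
    -- One accepting transition places the run in `𝒜_𝒢`, which it cannot leave. The semantic
    -- condition is established there and then pulled back to position `0`.
    obtain ⟨N, 𝒢, s, ν, hN, -⟩ := (hacc none).exists
    have hN : π N = .inr ⟨𝒢, s⟩ := (Prod.mk.inj hN).1
    have hstep : ∀ n, ρ (n + 1) = (π n).step (w n) := fun n => (hrun n).2
    have hσ : ∀ n ≥ N, ∃ t : φ.CompState 𝒢, π n = .inr ⟨𝒢, t⟩ := by
      intro n hn
      induction n, hn using Nat.le_induction with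
      | base => exact ⟨s, hN⟩
      | succ n hn ih =>
        obtain ⟨t, ht⟩ := ih
        have h : ρ (n + 1) = .inr ⟨𝒢, t.step (w n)⟩ := by rw [hstep, ht]; rfl
        exact ⟨t.step (w n), eq_of_reflTransGen_ε (h ▸ (hrun (n + 1)).1)⟩
    have : Nonempty (φ.CompState 𝒢) := ⟨s⟩
    choose! σ hσ using hσ
    have hρ : ∀ n ≥ N, ρ (n + 1) = .inr ⟨𝒢, (σ n).step (w n)⟩ := by
      intro n hn
      rw [hstep, hσ n hn]
      rfl
    have hσ' : ∀ n ≥ N, σ (n + 1) = (σ n).step (w n) := by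
      intro n hn
      have h := eq_of_reflTransGen_ε (hρ n hn ▸ (hrun (n + 1)).1)
      rw [hσ (n + 1) (by omega)] at h
      simpa using h
    have hsat : (π N).Sat w N := by
      rw [hσ N le_rfl]
      refine (frequently_accTrans_iff hσ').1 fun i => ?_
      refine ((hacc i).and_eventually (Filter.eventually_ge_atTop N)).mono fun n hn => ?_
      have := hn.1
      rw [hρ n hn.2, hσ n hn.2] at this
      exact this
    rw [← h₀]
    clear * - hsat hstep hrun
    induction N with
    | zero => exact sat_of_reflTransGen_ε (hrun 0).1 hsat
    | succ n ih =>
      have := sat_of_reflTransGen_ε (hrun (n + 1)).1 hsat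
      rw [hstep] at this
      exact ih (AState.sat_step.1 this)
  · intro h
    obtain ⟨𝒢, k, hk⟩ := exists_sat_jump (w := w) φ
    -- The only possible `ε`-transition is at position `k`. A run that starts in the accepting
    -- component is left unchanged by `enter` and stays in its own subcomponent, which is why `𝒢'`
    -- below may differ from `𝒢`.
    let next : ℕ → φ.AState → φ.AState := fun n q => if n = k then q.enter 𝒢 else q
    let ρ : ℕ → φ.AState := fun n => n.rec q fun n q => (next n q).step (w n)
    have hρ : ∀ n, ρ (n + 1) = (next n (ρ n)).step (w n) := fun n => rfl
    have hnext : ∀ n (q : φ.AState), q.Sat w n → (next n q).Sat w n := by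
      intro n q hq
      simp only [next]
      split_ifs with hn
      · subst hn
        rcases q with c | s
        · exact hk c hq
        · exact hq
      · exact hq
    have hsat : ∀ n, (ρ n).Sat w n := by
      intro n
      induction n with
      | zero => exact h
      | succ n ih =>
        rw [hρ]
        exact AState.sat_step.2 (hnext n _ ih)
    obtain ⟨⟨𝒢', s⟩, hs⟩ : ∃ s, next k (ρ k) = .inr s := by
      simp only [next, if_true]
      rcases ρ k with c | s
      · exact ⟨_, rfl⟩
      · exact ⟨_, rfl⟩
    have hσ : ∀ n ≥ k, ∃ t : φ.CompState 𝒢', next n (ρ n) = .inr ⟨𝒢', t⟩ := by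
      intro n hn
      induction n, hn using Nat.le_induction with
      | base => exact ⟨s, hs⟩
      | succ n hn ih =>
        obtain ⟨t, ht⟩ := ih
        refine ⟨t.step (w n), ?_⟩
        rw [hρ, ht]
        exact if_neg (by omega)
    have : Nonempty (φ.CompState 𝒢') := ⟨s⟩
    choose! σ hσ using hσ
    have hσ' : ∀ n ≥ k, σ (n + 1) = (σ n).step (w n) := by
      intro n hn
      have h₁ := hσ (n + 1) (by omega)
      rw [hρ, hσ n hn] at h₁
      simp only [next, if_neg (show n + 1 ≠ k by omega)] at h₁
      simpa [AState.step] using h₁.symm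
    refine ⟨ρ, fun n => next n (ρ n), rfl, fun n => ⟨?_, rfl⟩, fun i => ?_⟩
    · simp only [next]
      split_ifs with hn
      · rcases ρ n with c | s
        · exact .single ⟨c, 𝒢, rfl, rfl⟩
        · exact .refl
      · exact .refl
    · have hsat' : (σ k).Sat w k := by
        have := hnext k _ (hsat k)
        rwa [hσ k le_rfl] at this
      refine (((frequently_accTrans_iff hσ').2 hsat' i).and_eventually
        (Filter.eventually_ge_atTop k)).mono fun n hn => ?_
      have h₁ := hn.1
      rw [← hσ n hn.2] at h₁
      have h₂ : ρ (n + 1) = .inr ⟨𝒢', (σ n).step (w n)⟩ := by rw [hρ, hσ n hn.2]; rfl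
      rw [h₂]
      exact h₁

/-! ### The base and its size -/

/-- The words that satisfy all formulas of `I`. -/
def conjLang (I : Finset (NNF Ap)) : Set (ℕ → Set Ap) := {w | ∀ χ ∈ I, Sat w χ 0}

/-- The words that satisfy `χ[𝒢]` for all `χ ∈ I`, and `X G (ψ[𝒢])` for all `G ψ ∈ 𝒢`, where
`𝒢` is a set of `G`-subformulas of `φ`. -/
noncomputable def conjGLang (φ : NNF Ap) (p : Finset (NNF Ap) × Finset (NNF Ap)) :
    Set (ℕ → Set Ap) :=
  {w | ∃ h : p.1 ⊆ φ.gsf, (∀ χ ∈ p.2, Sat w (GSet.eval (φ := φ) ⟨p.1, h⟩ χ) 0) ∧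
    ∀ ψ, glob ψ ∈ p.1 → ∀ j > 0, Sat w (GSet.eval (φ := φ) ⟨p.1, h⟩ ψ) j}

/-- A base of the automaton for `φ`. -/
noncomputable def base (φ : NNF Ap) : Set (Set (ℕ → Set Ap)) :=
  conjLang '' (φ.sf.powerset : Set (Finset (NNF Ap))) ∪
    conjGLang φ '' ((φ.gsf.powerset ×ˢ φ.sf.powerset : Finset _) : Set (_ × _))

theorem finite_base (φ : NNF Ap) : φ.base.Finite :=
  ((Finset.finite_toSet _).image _).union ((Finset.finite_toSet _).image _)

/-- With `n = |sf φ|`, the two families contribute at most `2 ^ n` and `2 ^ (2 * n)` languages;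
since `n ≥ 1`, their sum is at most `2 ^ (2 * n + 1) ≤ 2 ^ (3 * n)`. -/
theorem ncard_base_le (φ : NNF Ap) : φ.base.ncard ≤ 2 ^ (3 * φ.sf.card) := by
  classical
  have h₀ : 1 ≤ φ.sf.card := Finset.card_pos.2 ⟨φ, self_mem_sf φ⟩
  have h₁ : φ.gsf.card ≤ φ.sf.card := Finset.card_filter_le _ _
  refine (Set.ncard_union_le _ _).trans ?_
  have h₂ := Set.ncard_image_le (f := conjLang) (φ.sf.powerset.finite_toSet)
  have h₃ := Set.ncard_image_le (f := conjGLang φ)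
    ((φ.gsf.powerset ×ˢ φ.sf.powerset).finite_toSet)
  rw [Set.ncard_coe_finset, Finset.card_powerset] at h₂
  rw [Set.ncard_coe_finset, Finset.card_product, Finset.card_powerset, Finset.card_powerset,
    ← pow_add] at h₃
  have h₄ : 2 ^ φ.sf.card ≤ 2 ^ (2 * φ.sf.card) := Nat.pow_le_pow_right (by omega) (by omega)
  have h₅ : 2 ^ (φ.gsf.card + φ.sf.card) ≤ 2 ^ (2 * φ.sf.card) :=
    Nat.pow_le_pow_right (by omega) (by omega)
  have h₆ : 2 ^ (2 * φ.sf.card + 1) ≤ 2 ^ (3 * φ.sf.card) :=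
    Nat.pow_le_pow_right (by omega) (by omega)
  rw [pow_succ] at h₆
  omega

theorem sat_of_forall_patoms {w w' : ℕ → Set Ap} {S : Set (NNF Ap)} {c : PClass Ap}
    (hc : c ∈ boolComb S) (h : ∀ χ ∈ S, Sat w χ 0 → Sat w' χ 0) (hw : c.Sat w 0) :
    c.Sat w' 0 := by
  obtain ⟨χ, rfl, hχ⟩ := hc
  exact (peval_sat w' 0 χ).1 (peval_mono χ (fun ξ hξ => h ξ (hχ hξ)) ((peval_sat w 0 χ).2 hw))

/-- The witness is the conjunction of all relevant subformulas that `w` satisfies. Any other word in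
it satisfies at least as many, hence by monotonicity every formula in the state that `w` satisfies.
-/
theorem exists_mem_base {φ : NNF Ap} {q : φ.AState} {w : ℕ → Set Ap} (hw : q.Sat w 0) :
    ∃ b ∈ φ.base, w ∈ b ∧ ∀ w' ∈ b, q.Sat w' 0 := by
  classical
  rcases q with c | ⟨𝒢, s⟩
  · refine ⟨_, Or.inl ⟨φ.sf.filter fun χ => Sat w χ 0,
      Finset.mem_coe.2 (Finset.mem_powerset.2 (Finset.filter_subset _ _)), rfl⟩, ?_, ?_⟩
    · exact fun χ hχ => (Finset.mem_filter.1 hχ).2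
    · intro w' hw'
      exact sat_of_forall_patoms (reach_subset_boolComb_sf φ c.2)
        (fun χ hχ h => hw' χ (Finset.mem_filter.2 ⟨hχ, h⟩)) hw
  -- The index set consists of subformulas `χ` of `φ` whose evaluations hold, not of the evaluations
  -- `χ[𝒢]`, so that the indices range over subsets of `sf φ`.
  · refine ⟨_, Or.inr ⟨(𝒢.1, φ.sf.filter fun χ => Sat w (𝒢.eval χ) 0), ?_, rfl⟩, ?_, ?_⟩
    · exact Finset.mem_coe.2 (Finset.mem_product.2
        ⟨Finset.mem_powerset.2 𝒢.2, Finset.mem_powerset.2 (Finset.filter_subset _ _)⟩)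
    · exact ⟨𝒢.2, fun χ hχ => (Finset.mem_filter.1 hχ).2, fun ψ hψ => (hw.2 ⟨ψ, hψ⟩).2.2⟩
    · rintro w' ⟨_, h₁, h₂⟩
      have h : ∀ χ ∈ 𝒢.evalSf, Sat w χ 0 → Sat w' χ 0 := by
        rintro _ ⟨χ, hχ, rfl⟩ h
        exact h₁ χ (Finset.mem_filter.2 ⟨hχ, h⟩)
      refine ⟨sat_of_forall_patoms (monStates_subset_boolComb φ 𝒢 s.1.2) h hw.1, fun i => ?_⟩
      have hi := bpStates_subset_boolComb 𝒢 i.2 (s.2 i).2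
      exact ⟨sat_of_forall_patoms hi.1 h (hw.2 i).1, sat_of_forall_patoms hi.2 h (hw.2 i).2.1,
        h₂ i.1 i.2⟩

theorem hasBase_base (φ : NNF Ap) : φ.ldba.HasBase φ.base := by
  refine ⟨φ.finite_base, fun q => ⟨{b ∈ φ.base | b ⊆ φ.ldba.lang q}, Set.sep_subset _ _, ?_⟩⟩
  refine Set.Subset.antisymm (fun w hw => ?_) (Set.sUnion_subset fun b hb => hb.2)
  obtain ⟨b, hb, hwb, h⟩ := exists_mem_base (mem_lang_iff.1 hw)
  exact ⟨b, ⟨hb, fun w' hw' => mem_lang_iff.2 (h w' hw')⟩, hwb⟩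

end NNF

theorem mainTheorem8 :
    ∃ C : ℕ, ∀ (Ap : Type u) [Finite Ap] (φ : LTL Ap),
      ∃ B : Set (Set (ℕ → Set Ap)), φ.ldba.HasBase B ∧ B.ncard ≤ 2 ^ (C * φ.size) := by
  -- `15 = 3 * 5`: the exponent in `ncard_base_le` times the growth factor of the normal form in
  -- `LTL.card_sf_nnf_le`.
  refine ⟨15, fun Ap _ φ => ⟨φ.nnf.base, φ.nnf.hasBase_base, φ.nnf.ncard_base_le.trans ?_⟩⟩
  have := φ.card_sf_nnf_le
  exact Nat.pow_le_pow_right (by omega) (by omega)
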